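/- Let $d\ge 2$ be an integer, let $c\in\mathbb{C}$ and let $f(z)=z^d+c$. Suppose that $f$ has no attracting cycle in $\mathbb{C}$, that is, there are no $p\ge 1$ and $z\in\mathbb{C}$ with $f^p(z)=z$ and $|Df^p(z)|<1$. Let $\bar x=\{x_{-n}\}_{n=0}^\infty$ be any backward orbit of the critical point $0$, that is, a sequence in $\mathbb{C}$ with $x_0=0$ and $f(x_{-n})=x_{-(n-1)}$ for all $n>0$. Then $$\chi_-^{back}(f,\bar x):=\liminf_{n\to\infty}\frac1n\log|Df^n(x_{-n})|\ge 0 .$$ -/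

import Mathlib

open Filter

noncomputable section

/-- The unicritical polynomial map `z ↦ z ^ d + c` of the complex plane. -/
def unicritical (d : ℕ) (c : ℂ) : ℂ → ℂ := fun z => z ^ d + c

/-- `f` has an attracting cycle in `ℂ`: there is a point `z` with `f^p(z) = z` for some `p ≥ 1`
whose multiplier `Df^p(z)` has modulus less than `1` (superattracting cycles are included). -/
def HasAttractingCycle (f : ℂ → ℂ) : Prop :=
  ∃ (p : ℕ) (z : ℂ), 0 < p ∧ Function.IsPeriodicPt f p z ∧ ‖deriv f^[p] z‖ < 1

/-- `x` is a backward orbit of `a` under `f`; the entry `x n` is the point `x_{-n}`. -/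
def IsBackwardOrbit (f : ℂ → ℂ) (a : ℂ) (x : ℕ → ℂ) : Prop :=
  x 0 = a ∧ ∀ n : ℕ, f (x (n + 1)) = x n

/-- The lower Lyapunov exponent along a backward orbit,
`liminf_{n → ∞} (1/n) log |Df^n(x_{-n})|`, as an extended real number, with `log 0 = -∞`. -/
def lowerBackwardExponent (f : ℂ → ℂ) (x : ℕ → ℂ) : EReal :=
  liminf (fun n : ℕ => ((1 / (n : ℝ) : ℝ) : EReal) * ENNReal.log ‖deriv f^[n] (x n)‖ₑ) atTop

end

/-! An iterate that contracts a disc into itself gives an attracting cycle, so undistorted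
contraction is impossible. Within relative distance `κ` of an orbit point, `|f'|` grows by at most
`exp η`, which `inflated` accounts for. Applied to discs about `0`, this bounds each return's
derivative below (`IsNextReturn.le_inflated`). As `0` is not periodic, returns to a small disc are
rare and these losses cost only `O(η)` per unit time. If the derivatives still decayed linearly,
there would be many record lows, two of them at nearby points since the orbit is bounded. The
iterate joining them contracts, so it must be distorted near `0` (`exists_distorted_time`). The
chain of returns from there regains the loss on leaving the disc (`exists_exit`), contradicting the
record (`exists_linear_lower_bound`). -/

/-! ### Combinatorics of returns -/

/-- The derivative of an iterate of length `l - j` at the `l`-th entry of a backward orbit whose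
logarithmic derivatives are `a`, inflated by the factor `exp (η * (l - j))`. -/
noncomputable def inflated (η : ℝ) (a : ℕ → ℝ) (l j : ℕ) : ℝ :=
  Real.exp (a l - a j + η * ((l : ℝ) - j))

theorem inflated_pos (η : ℝ) (a : ℕ → ℝ) (l j : ℕ) : 0 < inflated η a l j :=
  Real.exp_pos _

theorem inflated_mul (η : ℝ) (a : ℕ → ℝ) (l m j : ℕ) :
    inflated η a l m * inflated η a m j = inflated η a l j := by
  unfold inflated
  rw [← Real.exp_add]
  ring_nf

theorem log_inflated (η : ℝ) (a : ℕ → ℝ) (l j : ℕ) :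
    Real.log (inflated η a l j) = a l - a j + η * ((l : ℝ) - j) :=
  Real.log_exp _

/-- `j` is the first time after `l` at which the image of the disc of radius `r l` about `0` is
comparable to its distance from `0`. -/
def IsNextReturn (η κ : ℝ) (r a : ℕ → ℝ) (l j : ℕ) : Prop :=
  j < l ∧ κ * r j < 2 * r l * inflated η a l j ∧
    ∀ i, j < i → i < l → 2 * r l * inflated η a l i ≤ κ * r i

theorem exists_isNextReturn (η κ : ℝ) {r : ℕ → ℝ} (a : ℕ → ℝ) (h0 : r 0 = 0) {l : ℕ}
    (hl : 0 < l) (hr : 0 < r l) : ∃ j, IsNextReturn η κ r a l j := by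
  classical
  let P : ℕ → Prop := fun j => κ * r j < 2 * r l * inflated η a l j ∧ j < l
  have hP0 : P 0 := by
    refine ⟨?_, hl⟩
    rw [h0, mul_zero]
    have := inflated_pos η a l 0
    positivity
  have hspec : P (Nat.findGreatest P l) := Nat.findGreatest_spec (Nat.zero_le l) hP0
  refine ⟨Nat.findGreatest P l, hspec.2, hspec.1, fun i hi hil => ?_⟩
  by_contra hcon
  exact Nat.findGreatest_is_greatest hi hil.le ⟨not_le.mp hcon, hil⟩

/-- The index `l` is deep if the chain of successive returns starting at `l` stays in the disc of
radius `δ` until it reaches the index `0`. -/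
inductive IsDeep (η κ δ : ℝ) (r a : ℕ → ℝ) : ℕ → Prop
  | zero : IsDeep η κ δ r a 0
  | step {l j : ℕ} : r l < δ → IsNextReturn η κ r a l j → IsDeep η κ δ r a j →
      IsDeep η κ δ r a l

/-- Return intervals do not cross: if `j` fell strictly inside a return of the deep chain, smallness
at `b` and then at `j` would compose, and `j` would not be a return of `l`. So `j` lies on the chain
of `b`. -/
theorem IsNextReturn.isDeep_of_le {η κ δ : ℝ} {r a : ℕ → ℝ} (hκ : κ ≤ 2)
    (hr : ∀ l, 0 ≤ r l) {b : ℕ} (hb : IsDeep η κ δ r a b) {l j : ℕ}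
    (hj : IsNextReturn η κ r a l j) (hbl : b < l) (hjb : j ≤ b) : IsDeep η κ δ r a j := by
  induction hb with
  | zero => rw [Nat.le_zero.mp hjb]; exact .zero
  | @step b i hrb hi hdeep ih =>
    rcases hjb.eq_or_lt with rfl | hlt
    · exact .step hrb hi hdeep
    · refine ih (hi.1.trans hbl) ?_
      by_contra hcon
      have h1 := hi.2.2 j (not_le.mp hcon) hlt
      have h2 := hj.2.2 b hlt hbl
      have h3 := hj.2.1
      rw [← inflated_mul η a l b j] at h3
      have h4 : 2 * r l * (inflated η a l b * inflated η a b j)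
          ≤ 2 * r b * inflated η a b j := by
        rw [← mul_assoc]
        refine mul_le_mul_of_nonneg_right (h2.trans ?_) (inflated_pos η a b j).le
        exact mul_le_mul_of_nonneg_right hκ (hr b)
      linarith

/-- Each return lasts at least `N`, so its loss `η * N` costs at most `η` per unit time; undoing the
inflation costs another `η`. -/
theorem IsDeep.neg_le {η κ δ : ℝ} {r a : ℕ → ℝ} {N : ℕ} (hη : 0 ≤ η) (ha : a 0 = 0)
    (hδ : 0 < δ) (h0 : r 0 = 0)
    (hreturn : ∀ l j, IsNextReturn η κ r a l j → Real.exp (-(η * N)) ≤ inflated η a l j)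
    (hsep : ∀ l j, j < l → r l < δ → r j < δ → j + N ≤ l)
    {l : ℕ} (hl : IsDeep η κ δ r a l) : -(2 * η * l) ≤ a l := by
  induction hl with
  | zero => simp [ha]
  | @step l j hrl hj hdeep ih =>
    have hrj : r j < δ := by
      cases hdeep with
      | zero => rwa [h0]
      | step h _ _ => exact h
    have h1 : ((j + N : ℕ) : ℝ) ≤ l := by exact_mod_cast hsep l j hj.1 hrl hrj
    have h2 := Real.exp_le_exp.mp (hreturn l j hj)
    push_cast at h1
    nlinarith

/-- From an index inside the disc of radius `δ` that is not deep, the chain of successive returns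
leaves the disc before passing a deep index. -/
theorem exists_exit {η κ δ : ℝ} {r a : ℕ → ℝ} {N : ℕ} (hη : 0 ≤ η) (hκ0 : 0 < κ) (hκ : κ ≤ 2)
    (h0 : r 0 = 0) (hr : ∀ l, 0 < l → 0 < r l)
    (hN : Real.exp (-(η * N)) ≤ κ / 2)
    (hsep : ∀ l j, j < l → r l < δ → r j < δ → j + N ≤ l)
    (l : ℕ) (hl : ¬ IsDeep η κ δ r a l) (hrl : r l < δ) :
    ∃ e < l, δ ≤ r e ∧ (∀ b < l, IsDeep η κ δ r a b → b ≤ e) ∧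
      Real.log (δ / r l) + Real.log (κ / 2) - 2 * η * ((l : ℝ) - e) ≤ a l - a e := by
  induction l using Nat.strong_induction_on with
  | _ l ih =>
  have hl0 : 0 < l := by
    rcases Nat.eq_zero_or_pos l with rfl | h
    · exact absurd .zero hl
    · exact h
  have hr0 : ∀ i, 0 ≤ r i := fun i => by
    rcases Nat.eq_zero_or_pos i with rfl | h
    · exact h0.ge
    · exact (hr i h).le
  obtain ⟨j, hj⟩ := exists_isNextReturn η κ a h0 hl0 (hr l hl0)
  have hjdeep : ¬ IsDeep η κ δ r a j := fun h => hl (.step hrl hj h)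
  have hj0 : 0 < j := by
    rcases Nat.eq_zero_or_pos j with rfl | h
    · exact absurd .zero hjdeep
    · exact h
  have hbj : ∀ b < l, IsDeep η κ δ r a b → b < j := fun b hb hd => by
    by_contra hcon
    exact hjdeep (hj.isDeep_of_le hκ hr0 hd hb (not_lt.mp hcon))
  have hrl0 := hr l hl0
  have hrj0 := hr j hj0
  have hgain : Real.log (r j / r l) + Real.log (κ / 2) - η * ((l : ℝ) - j) ≤ a l - a j := by
    have h1 : r j / r l * (κ / 2) ≤ inflated η a l j := by
      rw [div_mul_div_comm, div_le_iff₀ (by positivity)]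
      nlinarith [hj.2.1]
    have h2 := Real.log_le_log (by positivity) h1
    rw [Real.log_mul (by positivity) (by positivity), log_inflated] at h2
    linarith
  have hjl : (j : ℝ) < l := by exact_mod_cast hj.1
  by_cases hrj : r j < δ
  · obtain ⟨e, hej, hre, hbe, hae⟩ := ih j hj.1 hjdeep hrj
    refine ⟨e, hej.trans hj.1, hre, fun b hb hd => hbe b (hbj b hb hd) hd, ?_⟩
    -- The radii telescope along the chain, and the length of this return pays for its constant `κ /
    -- 2`.
    have h1 : ((j + N : ℕ) : ℝ) ≤ l := by exact_mod_cast hsep l j hj.1 hrl hrj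
    push_cast at h1
    have h2 : -(η * N) ≤ Real.log (κ / 2) := by
      rw [← Real.log_exp (-(η * N))]
      exact Real.log_le_log (Real.exp_pos _) hN
    have hδ : 0 < δ := hrl0.trans hrl
    have h3 : Real.log (δ / r l) = Real.log (r j / r l) + Real.log (δ / r j) := by
      rw [← Real.log_mul (by positivity) (by positivity)]
      congr 1
      field_simp
    nlinarith
  · refine ⟨j, hj.1, not_lt.mp hrj, fun b hb hd => (hbj b hb hd).le, ?_⟩
    have hδ : 0 < δ := hrl0.trans hrl
    have h1 : Real.log (δ / r l) ≤ Real.log (r j / r l) :=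
      Real.log_le_log (by positivity) (by gcongr; exact not_lt.mp hrj)
    nlinarith

/-- A real sequence with controlled upward jumps that climbs high has many record times. -/
theorem exists_records {G : ℕ → ℝ} {A : ℝ} (hA : 0 ≤ A) {b k N : ℕ} (hb : G b ≤ 0) (hbk : b ≤ k)
    (hjump : ∀ l, b < l → l ≤ k → ∃ j, b ≤ j ∧ j < l ∧ G l ≤ G j + A) (hk : N * A < G k) :
    ∃ t : ℕ → ℕ, ∀ m ≤ N, (b < t m ∧ t m ≤ k ∧ ∀ j, b ≤ j → j < t m → G j < G (t m)) ∧
      ∀ m' < m, t m' < t m := by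
  classical
  have hex : ∀ m ≤ N, ∃ l, b ≤ l ∧ m * A < G l := fun m hm => ⟨k, hbk, by
    have : (m : ℝ) ≤ N := by exact_mod_cast hm
    nlinarith⟩
  -- First passage above level `m * A`. Jumps are at most `A`, so distinct levels have distinct
  -- passage times.
  let t : ℕ → ℕ := fun m => if h : m ≤ N then Nat.find (hex m h) else 0
  have ht : ∀ m, m ≤ N → (b ≤ t m ∧ m * A < G (t m)) ∧ t m ≤ k ∧
      ∀ j, b ≤ j → j < t m → G j ≤ m * A := fun m hm => by
    have hkm : (m : ℝ) ≤ N := by exact_mod_cast hm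
    simp only [t, dif_pos hm]
    refine ⟨Nat.find_spec (hex m hm), Nat.find_min' _ ⟨hbk, by nlinarith⟩, fun j hj hjt => ?_⟩
    have := Nat.find_min (hex m hm) hjt
    by_contra hcon
    exact this ⟨hj, not_le.mp hcon⟩
  have hlt : ∀ m, m ≤ N → b < t m := fun m hm => by
    refine lt_of_le_of_ne (ht m hm).1.1 fun h => ?_
    have h1 := (ht m hm).1.2
    rw [← h] at h1
    have : 0 ≤ (m : ℝ) * A := by positivity
    linarith
  refine ⟨t, fun m hm => ⟨⟨hlt m hm, (ht m hm).2.1, fun j hj hjt =>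
    ((ht m hm).2.2 j hj hjt).trans_lt (ht m hm).1.2⟩, fun m' hm' => ?_⟩⟩
  have hm'N : m' ≤ N := hm'.le.trans hm
  obtain ⟨j, hbj, hjt, hj⟩ := hjump (t m') (hlt m' hm'N) (ht m' hm'N).2.1
  have h1 := (ht m' hm'N).2.2 j hbj hjt
  have h2 := (ht m hm).1.2
  have h3 : ((m' + 1 : ℕ) : ℝ) ≤ m := by exact_mod_cast hm'
  push_cast at h3
  have h4 : ((m' : ℝ) + 1) * A ≤ m * A := mul_le_mul_of_nonneg_right h3 hA
  by_contra hcon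
  rcases (not_lt.mp hcon).eq_or_lt with h | h
  · rw [h] at h2; linarith
  · have h5 := (ht m' hm'N).2.2 (t m) (hlt m hm).le h
    linarith

/-- The combinatorial core: a sequence of logarithmic derivatives along a backward orbit of the
critical point cannot decay linearly, if returns do not contract and no two nearby record times are
joined by an undistorted iterate. The orbit is coded by a finite colouring `q`. -/
theorem exists_linear_lower_bound {η κ δ A : ℝ} {r a : ℕ → ℝ} {N K : ℕ} (hη : 0 < η)
    (hκ0 : 0 < κ) (hκ : κ ≤ 2) (hδ : 0 < δ) (h0 : r 0 = 0) (hr : ∀ l, 0 < l → 0 < r l)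
    (ha : a 0 = 0) (hN : Real.exp (-(η * N)) ≤ κ / 2)
    (hreturn : ∀ l j, IsNextReturn η κ r a l j → Real.exp (-(η * N)) ≤ inflated η a l j)
    (hsep : ∀ l j, j < l → r l < δ → r j < δ → j + N ≤ l)
    (hfar : ∀ l, δ ≤ r (l + 1) → a l - A ≤ a (l + 1))
    (q : ℕ → Fin K)
    (hq : ∀ k l, l < k → q k = q l → inflated η a k l ≤ Real.exp (-(2 * η)) →
      ∃ j, l < j ∧ j ≤ k ∧ κ * r j < κ ^ 2 * δ / 2 * inflated η a k j) :
    ∃ B, ∀ k : ℕ, -(3 * η * k) - B ≤ a k := by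
  classical
  set A' : ℝ := max 0 (max A (-Real.log (κ / 2)))
  have hA'0 : 0 ≤ A' := le_max_left _ _
  have hA'A : A ≤ A' := (le_max_left _ _).trans (le_max_right _ _)
  have hA'κ : -Real.log (κ / 2) ≤ A' := (le_max_right _ _).trans (le_max_right _ _)
  refine ⟨K * A', fun k => ?_⟩
  by_contra hcon
  -- The rate `3 * η` exceeds the `2 * η` lost by chains and leaves a contraction `2 * η` between
  -- records after inflation.
  set G : ℕ → ℝ := fun l => -(a l + 3 * η * l) with hG
  have hGk : K * A' < G k := by simp only [hG]; linarith
  let D : ℕ → Prop := IsDeep η κ δ r a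
  have hGD : ∀ l, D l → G l ≤ 0 := fun l hl => by
    have h1 := hl.neg_le hη.le ha hδ h0 hreturn hsep
    have h2 : 0 ≤ η * l := by positivity
    simp only [hG]
    linarith
  set b : ℕ := Nat.findGreatest D k
  have hbD : D b := Nat.findGreatest_spec (Nat.zero_le k) .zero
  have hbmax : ∀ l, b < l → l ≤ k → ¬ D l := fun l h1 h2 => Nat.findGreatest_is_greatest h1 h2
  have hexit := exists_exit (a := a) hη.le hκ0 hκ h0 hr hN hsep
  have hjump : ∀ l, b < l → l ≤ k → ∃ j, b ≤ j ∧ j < l ∧ G l ≤ G j + A' := fun l hbl hlk => by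
    by_cases hrl : r l < δ
    · obtain ⟨e, hel, -, hbe, hae⟩ := hexit l (hbmax l hbl hlk) hrl
      refine ⟨e, hbe b hbl hbD, hel, ?_⟩
      have hel' : (e : ℝ) < l := by exact_mod_cast hel
      have hrl0 := hr l (Nat.zero_lt_of_lt hbl)
      have : 0 ≤ Real.log (δ / r l) := Real.log_nonneg (by rw [le_div_iff₀ hrl0]; linarith)
      simp only [hG]
      nlinarith
    · obtain ⟨m, rfl⟩ : ∃ m, l = m + 1 := ⟨l - 1, by omega⟩
      refine ⟨m, by omega, by omega, ?_⟩
      have := hfar m (not_lt.mp hrl)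
      simp only [hG]
      push_cast
      linarith
  obtain ⟨t, ht⟩ := exists_records hA'0 (hGD b hbD) (Nat.findGreatest_le k) hjump hGk
  obtain ⟨m, m', hmm, hqm⟩ : ∃ m m' : Fin (K + 1), m < m' ∧ q (t m) = q (t m') := by
    obtain ⟨m, m', hne, he⟩ := Fintype.exists_ne_map_eq_of_card_lt
      (fun m : Fin (K + 1) => q (t m)) (by simp)
    rcases lt_or_gt_of_ne hne with h | h
    · exact ⟨m, m', h, he⟩
    · exact ⟨m', m, h, he.symm⟩
  have htm := (ht m (by omega)).1
  obtain ⟨⟨hb2, hk2, hrec⟩, hmono⟩ := ht m' (by omega)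
  have hlt := hmono m hmm
  generalize t m = l at *
  generalize t m' = s at *
  have hinf : ∀ j, b ≤ j → j < s → inflated η a s j ≤ Real.exp (-(2 * η)) := fun j hbj hjs => by
    have h1 := hrec j hbj hjs
    have h2 : ((j + 1 : ℕ) : ℝ) ≤ s := by exact_mod_cast hjs
    push_cast at h2
    simp only [hG] at h1
    exact Real.exp_le_exp.mpr (by nlinarith)
  obtain ⟨j, hlj, hjs, hj⟩ := hq s l hlt hqm.symm (hinf l htm.1.le hlt)
  have hbj : b < j := htm.1.trans hlj
  have hrj0 := hr j (Nat.zero_lt_of_lt hbj)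
  have hinf1 : inflated η a s j ≤ 1 := by
    rcases hjs.eq_or_lt with rfl | h
    · simp [inflated]
    · exact (hinf j hbj.le h).trans (Real.exp_le_one_iff.mpr (by linarith))
  have hrj : r j < δ := by
    have h1 : κ * r j < κ * δ := by
      calc κ * r j < κ ^ 2 * δ / 2 * inflated η a s j := hj
        _ ≤ κ ^ 2 * δ / 2 * 1 := by gcongr
        _ = κ * δ * (κ / 2) := by ring
        _ ≤ κ * δ * 1 := by gcongr; linarith
        _ = κ * δ := mul_one _
    exact lt_of_mul_lt_mul_left h1 hκ0.le
  -- The exit gain from `j` cancels the lower bound `h2` exactly, logarithms included, leaving a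
  -- loss below `3 * η` per unit time from `s` to `e`.
  obtain ⟨e, hej, -, hbe, hae⟩ := hexit j (hbmax j hbj (hjs.trans hk2)) hrj
  have hes : e < s := hej.trans_le hjs
  have h1 := hrec e (hbe b hbj hbD) hes
  have h2 : Real.log (r j / δ) - Real.log (κ / 2) ≤ a s - a j + η * ((s : ℝ) - j) := by
    rw [← log_inflated, ← Real.log_div (by positivity) (by positivity)]
    refine Real.log_le_log (by positivity) ?_
    rw [div_div, div_le_iff₀ (by positivity)]
    have : κ * r j < κ * (inflated η a s j * (δ * (κ / 2))) := by
      convert hj using 1; ring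
    exact (lt_of_mul_lt_mul_left this hκ0.le).le
  have h3 : Real.log (r j / δ) = -Real.log (δ / r j) := by rw [← Real.log_inv, inv_div]
  have h4 : (e : ℝ) < s := by exact_mod_cast hes
  have h5 : (j : ℝ) ≤ s := by exact_mod_cast hjs
  simp only [hG] at h1
  nlinarith

/-! ### Derivatives and attracting cycles -/

theorem hasDerivAt_unicritical (d : ℕ) (c z : ℂ) :
    HasDerivAt (unicritical d c) (d * z ^ (d - 1)) z :=
  (hasDerivAt_pow d z).add_const c

theorem norm_deriv_unicritical (d : ℕ) (c z : ℂ) :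
    ‖deriv (unicritical d c) z‖ = d * ‖z‖ ^ (d - 1) := by
  rw [(hasDerivAt_unicritical d c z).deriv]
  simp

theorem differentiable_unicritical (d : ℕ) (c : ℂ) : Differentiable ℂ (unicritical d c) :=
  fun z => (hasDerivAt_unicritical d c z).differentiableAt

theorem deriv_iterate_succ {f : ℂ → ℂ} (hf : Differentiable ℂ f) (n : ℕ) (z : ℂ) :
    deriv f^[n + 1] z = deriv f^[n] (f z) * deriv f z := by
  rw [Function.iterate_succ]
  exact deriv_comp z (hf.iterate n _) (hf z)

theorem deriv_iterate_succ' {f : ℂ → ℂ} (hf : Differentiable ℂ f) (n : ℕ) (z : ℂ) :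
    deriv f^[n + 1] z = deriv f (f^[n] z) * deriv f^[n] z := by
  rw [Function.iterate_succ']
  exact deriv_comp z (hf _) (hf.iterate n z)

theorem IsBackwardOrbit.iterate_apply {f : ℂ → ℂ} {p : ℂ} {x : ℕ → ℂ} (hx : IsBackwardOrbit f p x)
    (n j : ℕ) : f^[n] (x (j + n)) = x j := by
  induction n with
  | zero => rfl
  | succ n ih => rw [Function.iterate_succ_apply, ← add_assoc, hx.2, ih]

/-- An iterate that contracts a closed disc into itself has an attracting fixed point. -/
theorem hasAttractingCycle_of_mapsTo {f : ℂ → ℂ} (hf : Differentiable ℂ f) {n : ℕ} (hn : 0 < n)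
    {p : ℂ} {ρ L : ℝ} (hρ : 0 ≤ ρ) (hL : L < 1)
    (hmaps : Set.MapsTo f^[n] (Metric.closedBall p ρ) (Metric.closedBall p ρ))
    (hderiv : ∀ z ∈ Metric.closedBall p ρ, ‖deriv f^[n] z‖ ≤ L) : HasAttractingCycle f := by
  have hp : p ∈ Metric.closedBall p ρ := Metric.mem_closedBall_self hρ
  have hL0 : 0 ≤ L := (norm_nonneg _).trans (hderiv p hp)
  lift L to NNReal using hL0
  have hlip : LipschitzOnWith L f^[n] (Metric.closedBall p ρ) :=
    (convex_closedBall p ρ).lipschitzOnWith_of_nnnorm_deriv_le (𝕜 := ℂ)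
      (fun z _ => hf.iterate n z) hderiv
  have hcontr : ContractingWith L (hmaps.restrict f^[n] _ _) :=
    ⟨by exact_mod_cast hL, hlip.mapsToRestrict hmaps⟩
  obtain ⟨y, hy, hfix, -⟩ := ContractingWith.exists_fixedPoint'
    Metric.isClosed_closedBall.isComplete hmaps hcontr hp (edist_ne_top _ _)
  exact ⟨n, y, hn, hfix, (hderiv y hy).trans_lt hL⟩

/-- Without attracting cycles the critical point is not periodic. -/
theorem iterate_zero_ne_zero {d : ℕ} (hd : 2 ≤ d) {c : ℂ}
    (hf : ¬ HasAttractingCycle (unicritical d c)) {n : ℕ} (hn : 0 < n) :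
    (unicritical d c)^[n] 0 ≠ 0 := by
  intro h
  refine hf ⟨n, 0, hn, h, ?_⟩
  obtain ⟨m, rfl⟩ : ∃ m, n = m + 1 := ⟨n - 1, by omega⟩
  rw [deriv_iterate_succ (differentiable_unicritical d c), norm_mul, norm_deriv_unicritical,
    norm_zero, zero_pow (by omega)]
  simp

theorem norm_lt_of_isBackwardOrbit {d : ℕ} (hd : 2 ≤ d) {c : ℂ} {x : ℕ → ℂ}
    (hx : IsBackwardOrbit (unicritical d c) 0 x) (n : ℕ) : ‖x n‖ < ‖c‖ + 2 := by
  induction n with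
  | zero => rw [hx.1, norm_zero]; positivity
  | succ n ih =>
    by_contra! hcon
    have h1 : x (n + 1) ^ d = x n - c := by
      rw [← hx.2 n]; simp [unicritical]
    have h2 : ‖x (n + 1)‖ ^ d ≤ ‖x n‖ + ‖c‖ := by
      rw [← norm_pow, h1]; exact norm_sub_le _ _
    have h3 : ‖x (n + 1)‖ ^ 2 ≤ ‖x (n + 1)‖ ^ d :=
      pow_le_pow_right₀ (by linarith [norm_nonneg c]) hd
    nlinarith [norm_nonneg c]

/-! ### Distortion along the backward orbit -/

section BackwardOrbit

/-- The logarithm of `|Df^n(x_{-n})|`. -/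
noncomputable def backwardLogDeriv (f : ℂ → ℂ) (x : ℕ → ℂ) (n : ℕ) : ℝ :=
  Real.log ‖deriv f^[n] (x n)‖

variable {d : ℕ} {c : ℂ} {x : ℕ → ℂ}

theorem IsBackwardOrbit.ne_zero (hd : 2 ≤ d) (hf : ¬ HasAttractingCycle (unicritical d c))
    (hx : IsBackwardOrbit (unicritical d c) 0 x) {n : ℕ} (hn : 0 < n) : x n ≠ 0 := fun h => by
  have h1 := hx.iterate_apply n 0
  rw [zero_add, h, hx.1] at h1
  exact iterate_zero_ne_zero hd hf hn h1

theorem IsBackwardOrbit.deriv_ne_zero (hd : 2 ≤ d) (hf : ¬ HasAttractingCycle (unicritical d c))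
    (hx : IsBackwardOrbit (unicritical d c) 0 x) (n : ℕ) :
    deriv (unicritical d c) (x (n + 1)) ≠ 0 := by
  rw [(hasDerivAt_unicritical d c _).deriv]
  exact mul_ne_zero (by exact_mod_cast (by omega : d ≠ 0))
    (pow_ne_zero _ (hx.ne_zero hd hf n.succ_pos))

theorem IsBackwardOrbit.deriv_iterate_ne_zero (hd : 2 ≤ d)
    (hf : ¬ HasAttractingCycle (unicritical d c))
    (hx : IsBackwardOrbit (unicritical d c) 0 x) (n : ℕ) :
    deriv (unicritical d c)^[n] (x n) ≠ 0 := by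
  induction n with
  | zero => simp
  | succ n ih =>
    rw [deriv_iterate_succ (differentiable_unicritical d c), hx.2]
    exact mul_ne_zero ih (hx.deriv_ne_zero hd hf n)

theorem backwardLogDeriv_succ (hd : 2 ≤ d) (hf : ¬ HasAttractingCycle (unicritical d c))
    (hx : IsBackwardOrbit (unicritical d c) 0 x) (n : ℕ) :
    backwardLogDeriv (unicritical d c) x (n + 1) =
      backwardLogDeriv (unicritical d c) x n + Real.log ‖deriv (unicritical d c) (x (n + 1))‖ := by
  unfold backwardLogDeriv
  rw [deriv_iterate_succ (differentiable_unicritical d c), hx.2, norm_mul, Real.log_mul]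
  · exact norm_ne_zero_iff.mpr (hx.deriv_iterate_ne_zero hd hf n)
  · exact norm_ne_zero_iff.mpr (hx.deriv_ne_zero hd hf n)

theorem inflated_succ (hd : 2 ≤ d) (hf : ¬ HasAttractingCycle (unicritical d c))
    (hx : IsBackwardOrbit (unicritical d c) 0 x) (η : ℝ) (n : ℕ) :
    inflated η (backwardLogDeriv (unicritical d c) x) (n + 1) n =
      ‖deriv (unicritical d c) (x (n + 1))‖ * Real.exp η := by
  unfold inflated
  rw [backwardLogDeriv_succ hd hf hx, show ∀ u v : ℝ, u + v - u = v from fun u v => by ring,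
    Real.exp_add, Real.exp_log (norm_pos_iff.mpr (hx.deriv_ne_zero hd hf n))]
  push_cast
  ring_nf

/-- As long as the images of a convex set around `x l` stay small compared with their distance to
the critical point, the derivative on the set is at most the inflated derivative at `x l`. -/
theorem norm_deriv_iterate_le_inflated (hd : 2 ≤ d) (hf : ¬ HasAttractingCycle (unicritical d c))
    (hx : IsBackwardOrbit (unicritical d c) 0 x) {η κ : ℝ}
    (hκη : (1 + κ) ^ (d - 1) ≤ Real.exp η) {l : ℕ} {S : Set ℂ}
    (hS : Convex ℝ S) (hxS : x l ∈ S) {D : ℝ} (hD : ∀ z ∈ S, ‖z - x l‖ ≤ D)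
    (hfirst : ∀ z ∈ S, ‖deriv (unicritical d c) z‖
      ≤ ‖deriv (unicritical d c) (x l)‖ * Real.exp η)
    (n j : ℕ) (hn : 0 < n) (hj : j + n = l)
    (hgood : ∀ i, j < i → i < l →
      D * inflated η (backwardLogDeriv (unicritical d c) x) l i ≤ κ * ‖x i‖) :
    ∀ z ∈ S, ‖deriv (unicritical d c)^[n] z‖
        ≤ inflated η (backwardLogDeriv (unicritical d c) x) l j ∧
      ‖(unicritical d c)^[n] z - x j‖ ≤ D * inflated η (backwardLogDeriv (unicritical d c) x) l j := by
  have hdiff := differentiable_unicritical d c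
  suffices h : ∀ z ∈ S, ‖deriv (unicritical d c)^[n] z‖
      ≤ inflated η (backwardLogDeriv (unicritical d c) x) l j by
    refine fun z hz => ⟨h z hz, ?_⟩
    have h1 := hS.norm_image_sub_le_of_norm_deriv_le (𝕜 := ℂ)
      (fun z _ => hdiff.iterate n z) h hxS hz
    rw [← hj, hx.iterate_apply, hj] at h1
    refine h1.trans ?_
    rw [mul_comm]
    exact mul_le_mul_of_nonneg_right (hD z hz) (inflated_pos _ _ _ _).le
  induction n, hn using Nat.le_induction generalizing j with
  | base =>
    subst hj
    intro z hz
    rw [Function.iterate_one, inflated_succ hd hf hx]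
    exact hfirst z hz
  | succ n hn ih =>
    have hjn : (j + 1) + n = l := by omega
    have ih' := ih (j + 1) hjn fun i hi hil => hgood i (by omega) hil
    intro z hz
    have h1 := hS.norm_image_sub_le_of_norm_deriv_le (𝕜 := ℂ)
      (fun z _ => hdiff.iterate n z) ih' hxS hz
    rw [← hjn, hx.iterate_apply, hjn] at h1
    have h2 : ‖(unicritical d c)^[n] z - x (j + 1)‖ ≤ κ * ‖x (j + 1)‖ := by
      refine h1.trans (le_trans ?_ (hgood (j + 1) (by omega) (by omega)))
      rw [mul_comm]
      exact mul_le_mul_of_nonneg_right (hD z hz) (inflated_pos _ _ _ _).le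
    have h3 : ‖(unicritical d c)^[n] z‖ ≤ (1 + κ) * ‖x (j + 1)‖ := by
      have := norm_sub_norm_le ((unicritical d c)^[n] z) (x (j + 1))
      linarith
    have h4 : ‖deriv (unicritical d c) ((unicritical d c)^[n] z)‖
        ≤ ‖deriv (unicritical d c) (x (j + 1))‖ * Real.exp η := by
      rw [norm_deriv_unicritical, norm_deriv_unicritical]
      calc (d : ℝ) * ‖(unicritical d c)^[n] z‖ ^ (d - 1)
          ≤ d * ((1 + κ) * ‖x (j + 1)‖) ^ (d - 1) := by gcongr
        _ = d * ‖x (j + 1)‖ ^ (d - 1) * (1 + κ) ^ (d - 1) := by rw [mul_pow]; ring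
        _ ≤ d * ‖x (j + 1)‖ ^ (d - 1) * Real.exp η := by gcongr
    rw [deriv_iterate_succ' hdiff, norm_mul, ← inflated_mul η _ l (j + 1) j,
      inflated_succ hd hf hx, mul_comm]
    exact mul_le_mul (ih' z hz) h4 (norm_nonneg _) (inflated_pos _ _ _ _).le

/-- Without attracting cycles, successive returns near the critical point do not contract. -/
theorem IsNextReturn.le_inflated (hd : 2 ≤ d) (hf : ¬ HasAttractingCycle (unicritical d c))
    (hx : IsBackwardOrbit (unicritical d c) 0 x) {η κ : ℝ} (hη : 0 ≤ η) (hκ : 0 < κ)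
    (hκη : (1 + κ) ^ (d - 1) ≤ Real.exp η) {l j : ℕ}
    (hj : IsNextReturn η κ (fun n => ‖x n‖) (backwardLogDeriv (unicritical d c) x) l j) :
    κ / (2 * (1 + κ)) ≤ inflated η (backwardLogDeriv (unicritical d c) x) l j := by
  obtain ⟨hjl, hbad, hgood⟩ := hj
  set M := inflated η (backwardLogDeriv (unicritical d c) x) l j
  have hM : 0 < M := inflated_pos _ _ _ _
  by_contra! hcon
  rw [lt_div_iff₀ (by positivity)] at hcon
  have hest := norm_deriv_iterate_le_inflated hd hf hx hκη
    (convex_closedBall (0 : ℂ) ‖x l‖) (by simp) (D := 2 * ‖x l‖)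
    (fun z hz => by
      have := norm_sub_le z (x l)
      rw [mem_closedBall_zero_iff] at hz
      linarith)
    -- The disc is centred at the critical point, so `|f'|` is maximal on its boundary, where `x l`
    -- lies.
    (fun z hz => by
      rw [mem_closedBall_zero_iff] at hz
      rw [norm_deriv_unicritical, norm_deriv_unicritical]
      calc (d : ℝ) * ‖z‖ ^ (d - 1) ≤ d * ‖x l‖ ^ (d - 1) * 1 := by rw [mul_one]; gcongr
        _ ≤ d * ‖x l‖ ^ (d - 1) * Real.exp η := by gcongr; exact Real.one_le_exp hη)
    (l - j) j (by omega) (by omega) hgood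
  refine hf (hasAttractingCycle_of_mapsTo (differentiable_unicritical d c)
    (n := l - j) (by omega) (norm_nonneg (x l)) (L := M) (by nlinarith) (fun z hz => ?_)
    fun z hz => (hest z hz).1)
  have h1 := (hest z hz).2
  rw [mem_closedBall_zero_iff]
  have h2 := norm_sub_norm_le ((unicritical d c)^[l - j] z) (x j)
  have h3 : κ * ‖(unicritical d c)^[l - j] z‖ ≤ κ * ‖x l‖ := by
    have h4 : κ * ‖(unicritical d c)^[l - j] z‖ ≤ κ * ‖x j‖ + κ * (2 * ‖x l‖ * M) := by
      rw [← mul_add]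
      exact mul_le_mul_of_nonneg_left (by linarith) hκ.le
    have h5 := mul_le_mul_of_nonneg_left hcon.le (norm_nonneg (x l))
    simp only at hbad
    nlinarith
  exact le_of_mul_le_mul_left h3 hκ

/-- Two nearby points of the backward orbit joined by an undistorted contracting iterate give rise
to an attracting cycle. -/
theorem exists_distorted_time (hd : 2 ≤ d) (hf : ¬ HasAttractingCycle (unicritical d c))
    (hx : IsBackwardOrbit (unicritical d c) 0 x) {η κ ρ L : ℝ} (hρ : 0 ≤ ρ) (hL : L < 1)
    (hκη : (1 + κ) ^ (d - 1) ≤ Real.exp η) {k l : ℕ} (hlk : l < k)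
    (hclose : dist (x l) (x k) ≤ (1 - L) * ρ)
    (hcontr : inflated η (backwardLogDeriv (unicritical d c) x) k l ≤ L) :
    ∃ j, l < j ∧ j ≤ k ∧ κ * ‖x j‖ < ρ * inflated η (backwardLogDeriv (unicritical d c) x) k j := by
  by_contra! hcon
  -- The case `j = k` controls the first step.
  have hgood0 : ρ ≤ κ * ‖x k‖ := by simpa [inflated] using hcon k hlk le_rfl
  have hest := norm_deriv_iterate_le_inflated hd hf hx hκη
    (convex_closedBall (x k) ρ) (Metric.mem_closedBall_self hρ) (D := ρ)
    (fun z hz => by rwa [Metric.mem_closedBall, dist_eq_norm] at hz)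
    (fun z hz => by
      rw [Metric.mem_closedBall, dist_eq_norm] at hz
      have h3 : ‖z‖ ≤ (1 + κ) * ‖x k‖ := by
        have := norm_sub_norm_le z (x k)
        linarith
      rw [norm_deriv_unicritical, norm_deriv_unicritical]
      calc (d : ℝ) * ‖z‖ ^ (d - 1) ≤ d * ((1 + κ) * ‖x k‖) ^ (d - 1) := by gcongr
        _ = d * ‖x k‖ ^ (d - 1) * (1 + κ) ^ (d - 1) := by rw [mul_pow]; ring
        _ ≤ d * ‖x k‖ ^ (d - 1) * Real.exp η := by gcongr)
    (k - l) l (by omega) (by omega) (fun i hi hik => hcon i hi hik.le)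
  -- The image lies within `L * ρ` of `x l`, hence within `ρ` of `x k`.
  refine hf (hasAttractingCycle_of_mapsTo (differentiable_unicritical d c)
    (n := k - l) (by omega) hρ hL (fun z hz => ?_) fun z hz => (hest z hz).1.trans hcontr)
  have h1 := (hest z hz).2
  rw [← dist_eq_norm] at h1
  have h2 := mul_le_mul_of_nonneg_left hcontr hρ
  have h3 := dist_triangle ((unicritical d c)^[k - l] z) (x l) (x k)
  rw [Metric.mem_closedBall]
  linarith

/-! ### Choice of constants and conclusion -/

/-- Returns to a small disc about the critical point take long. -/
theorem exists_return_time_ge (hd : 2 ≤ d) (hf : ¬ HasAttractingCycle (unicritical d c))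
    (hx : IsBackwardOrbit (unicritical d c) 0 x) (N : ℕ) :
    ∃ δ > 0, ∀ l j, j < l → ‖x l‖ < δ → ‖x j‖ < δ → j + N ≤ l := by
  have hev : ∀ n : ℕ, 0 < n → ∃ δ > 0, ∀ z : ℂ, ‖z‖ < δ → δ ≤ ‖(unicritical d c)^[n] z‖ := by
    intro n hn
    have hpos : 0 < ‖(unicritical d c)^[n] 0‖ := norm_pos_iff.mpr (iterate_zero_ne_zero hd hf hn)
    have hcont : ContinuousAt (fun z => ‖(unicritical d c)^[n] z‖) 0 :=
      ((differentiable_unicritical d c).continuous.iterate n).norm.continuousAt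
    obtain ⟨ε, hε, h⟩ := Metric.eventually_nhds_iff.mp
      (hcont.eventually (lt_mem_nhds (half_lt_self hpos)))
    refine ⟨min ε (‖(unicritical d c)^[n] 0‖ / 2), by positivity, fun z hz => ?_⟩
    exact (min_le_right _ _).trans
      (h (by rw [dist_zero_right]; exact hz.trans_le (min_le_left _ _))).le
  have hall : ∃ δ > 0, ∀ n : ℕ, 0 < n → n < N → ∀ z : ℂ, ‖z‖ < δ →
      δ ≤ ‖(unicritical d c)^[n] z‖ := by
    induction N with
    | zero => exact ⟨1, one_pos, fun n _ h => absurd h (Nat.not_lt_zero n)⟩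
    | succ N ih =>
      obtain ⟨δ, hδ, h⟩ := ih
      rcases Nat.eq_zero_or_pos N with rfl | hN
      · exact ⟨δ, hδ, fun n h0 h1 => by omega⟩
      obtain ⟨δ', hδ', h'⟩ := hev N hN
      refine ⟨min δ δ', lt_min hδ hδ', fun n hn hnN z hz => ?_⟩
      rcases (Nat.lt_succ_iff.mp hnN).eq_or_lt with rfl | hlt
      · exact (min_le_right _ _).trans (h' z (hz.trans_le (min_le_right _ _)))
      · exact (min_le_left _ _).trans (h n hn hlt z (hz.trans_le (min_le_left _ _)))
  obtain ⟨δ, hδ, h⟩ := hall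
  refine ⟨δ, hδ, fun l j hjl hl hj => ?_⟩
  by_contra! hcon
  have h1 := h (l - j) (by omega) (by omega) (x l) hl
  have h2 := hx.iterate_apply (l - j) j
  rw [show j + (l - j) = l by omega] at h2
  rw [h2] at h1
  linarith

theorem exists_colouring (hd : 2 ≤ d) (hx : IsBackwardOrbit (unicritical d c) 0 x) {ε : ℝ}
    (hε : 0 < ε) : ∃ (K : ℕ) (q : ℕ → Fin K), ∀ k l, q k = q l → dist (x l) (x k) ≤ ε := by
  have htb : TotallyBounded (Set.range x) :=
    (isCompact_closedBall (0 : ℂ) (‖c‖ + 2)).totallyBounded.subset (by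
      rintro _ ⟨n, rfl⟩
      rw [mem_closedBall_zero_iff]
      exact (norm_lt_of_isBackwardOrbit hd hx n).le)
  obtain ⟨t, ht, hcover⟩ := Metric.totallyBounded_iff.mp htb (ε / 2) (half_pos hε)
  have hmem : ∀ n, ∃ y : t, dist (x n) y < ε / 2 := fun n => by
    obtain ⟨y, hy, h⟩ := Set.mem_iUnion₂.mp (hcover ⟨n, rfl⟩)
    exact ⟨⟨y, hy⟩, h⟩
  choose y hy using hmem
  have := ht.fintype
  refine ⟨_, fun n => Fintype.equivFin t (y n), fun k l hkl => ?_⟩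
  have h1 : y k = y l := (Fintype.equivFin t).injective hkl
  have h2 := hy k
  rw [h1] at h2
  have := dist_triangle_right (x l) (x k) (y l)
  linarith [hy l]

theorem exists_backwardLogDeriv_lower_bound (hd : 2 ≤ d) (hf : ¬ HasAttractingCycle (unicritical d c))
    (hx : IsBackwardOrbit (unicritical d c) 0 x) {η : ℝ} (hη : 0 < η) :
    ∃ B, ∀ n : ℕ, -(3 * η * n) - B ≤ backwardLogDeriv (unicritical d c) x n := by
  obtain ⟨κ, hκ0, hκ1, hκη⟩ : ∃ κ : ℝ, 0 < κ ∧ κ ≤ 1 ∧ (1 + κ) ^ (d - 1) ≤ Real.exp η := by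
    have hcont : ContinuousAt (fun κ : ℝ => (1 + κ) ^ (d - 1)) 0 := by fun_prop
    obtain ⟨ε, hε, h⟩ := Metric.eventually_nhds_iff.mp
      (hcont.eventually (gt_mem_nhds (show (1 + (0 : ℝ)) ^ (d - 1) < Real.exp η by
        simpa using hη)))
    refine ⟨min (ε / 2) 1, by positivity, min_le_right _ _, (h ?_).le⟩
    rw [Real.dist_0_eq_abs, abs_of_pos (by positivity)]
    exact (min_le_left _ _).trans_lt (half_lt_self hε)
  obtain ⟨N, hN⟩ : ∃ N : ℕ, Real.exp (-(η * N)) ≤ κ / (2 * (1 + κ)) := by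
    obtain ⟨N, hN⟩ := exists_nat_ge (-Real.log (κ / (2 * (1 + κ))) / η)
    refine ⟨N, ?_⟩
    rw [← Real.le_log_iff_exp_le (by positivity)]
    rw [div_le_iff₀ hη] at hN
    linarith
  obtain ⟨δ, hδ, hsep⟩ := exists_return_time_ge hd hf hx N
  set L := Real.exp (-(2 * η))
  have hL : L < 1 := by
    rw [← Real.exp_zero]
    exact Real.exp_lt_exp.mpr (by linarith)
  set ρ := κ ^ 2 * δ / 2
  have hρ : 0 < ρ := by positivity
  obtain ⟨K, q, hq⟩ := exists_colouring hd hx (mul_pos (sub_pos.mpr hL) hρ)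
  refine exists_linear_lower_bound (κ := κ) (δ := δ) (A := -Real.log (d * δ ^ (d - 1)))
    (r := fun n => ‖x n‖) (N := N) hη hκ0 (by linarith) hδ (by simp [hx.1])
    (fun l hl => norm_pos_iff.mpr (hx.ne_zero hd hf hl)) (by simp [backwardLogDeriv])
    (hN.trans (by gcongr; linarith))
    (fun l j hj => hN.trans (hj.le_inflated hd hf hx hη.le hκ0 hκη)) hsep ?_ q
    fun k l hlk hkl hinf => exists_distorted_time hd hf hx hρ.le hL hκη hlk (hq k l hkl) hinf
  intro l hl
  rw [backwardLogDeriv_succ hd hf hx, norm_deriv_unicritical, sub_neg_eq_add]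
  have hd0 : (0 : ℝ) < d := by exact_mod_cast (by omega : 0 < d)
  gcongr

end BackwardOrbit

theorem theorem6 (d : ℕ) (hd : 2 ≤ d) (c : ℂ)
    (hf : ¬ HasAttractingCycle (unicritical d c))
    (x : ℕ → ℂ) (hx : IsBackwardOrbit (unicritical d c) 0 x) :
    0 ≤ lowerBackwardExponent (unicritical d c) x := by
  have hterm : ∀ n : ℕ, ((1 / (n : ℝ) : ℝ) : EReal) *
      ENNReal.log ‖deriv (unicritical d c)^[n] (x n)‖ₑ
        = ((1 / (n : ℝ) * backwardLogDeriv (unicritical d c) x n : ℝ) : EReal) := fun n => by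
    rw [← ofReal_norm,
      ENNReal.log_ofReal_of_pos (norm_pos_iff.mpr (hx.deriv_iterate_ne_zero hd hf n)),
      EReal.coe_mul, backwardLogDeriv]
  unfold lowerBackwardExponent
  simp only [hterm]
  refine EReal.ge_of_forall_gt_iff_ge.mp fun y hy => ?_
  have hy0 : y < 0 := by exact_mod_cast hy
  -- The rate `3 * η` is `-y / 2`; the other half absorbs `B`.
  obtain ⟨B, hB⟩ := exists_backwardLogDeriv_lower_bound hd hf hx (η := -y / 6) (by linarith)
  refine le_liminf_of_le (by isBoundedDefault) ?_
  obtain ⟨m, hm⟩ := exists_nat_ge (2 * B / -y)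
  filter_upwards [eventually_ge_atTop (m + 1)] with n hn
  have hn0 : (0 : ℝ) < n := by exact_mod_cast (by omega : 0 < n)
  have hmn : (m : ℝ) ≤ n := by exact_mod_cast (by omega : m ≤ n)
  have h1 := (div_le_iff₀ (by linarith)).mp (hm.trans hmn)
  rw [EReal.coe_le_coe_iff, one_div_mul_eq_div, le_div_iff₀ hn0]
  linarith [hB n]
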